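/- Let $k$ be a field of arbitrary characteristic, let $n\ge 1$, and let $F=\{x^{v_1},\dots,x^{v_q}\}$ be a finite non-empty set of distinct monomials of degree $2$ in $k[x_1,\dots,x_n]$ having no non-trivial (i.e. non-unit) common factor. Let $\widetilde{\mathcal G}$ be the graph, with loops allowed, on the vertex set $\{x_1,\dots,x_n\}$ whose edges and loops are the pairs $\{x_i,x_j\}$ (possibly $i=j$) with $x_ix_j\in F$, and let $\mathcal G$ be the simple graph on the same vertex set obtained from $\widetilde{\mathcal G}$ by omitting all loops. Let $A=(v_1,\dots,v_q)$ be the $n\times q$ integer matrix whose columns are the exponent vectors of the monomials in $F$ (the log-matrix of $F$, that is, the incidence matrix of $\widetilde{\mathcal G}$, in which a loop at $x_i$ has column $2e_i$). Call $F$ cohesive if its members have no non-trivial common factor and there are no partition $\{x_1,\dots,x_n\}=\mathbf y\sqcup\mathbf z$ of the variables and decomposition $F=G\cup H$ with $G$, $H$ non-empty such that the members of $G$ involve only variables in $\mathbf y$ and those of $H$ only variables in $\mathbf z$. Let $k[\mathbf x_2]$ be the $k$-subalgebra of $k[x_1,\dots,x_n]$ generated by all monomials of degree $2$, and call an extension of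 integral domains birational if it induces an equality of fields of fractions. Then the following conditions are equivalent: (i) $F$ is cohesive and $A$ has maximal rank, i.e. $\operatorname{rank}(A)=n$; (ii) the extension $k[F]\subset k[\mathbf x_2]$ is birational; (iii) $\mathcal G$ is connected and, moreover, either $\mathcal G$ is non-bipartite, or $\mathcal G$ is bipartite and $\widetilde{\mathcal G}\setminus\mathcal G\ne\emptyset$, i.e. $\widetilde{\mathcal G}$ has at least one loop. -/

import Mathlib

/-- The polynomials in `S` have no non-trivial common factor. -/
def NoCommonFactor {σ k : Type*} [Field k] (S : Set (MvPolynomial σ k)) : Prop :=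
  ∀ g : MvPolynomial σ k, (∀ f ∈ S, g ∣ f) → IsUnit g

/-- `S` can be disconnected: there are a partition `Y ∪ Z` of the variables and a decomposition
`S = G ∪ H` with `G`, `H` non-empty, `G` involving only variables in `Y` and `H` only
variables in `Z`. -/
def CanBeDisconnected {σ k : Type*} [Field k] (S : Set (MvPolynomial σ k)) : Prop :=
  ∃ (Y Z : Set σ) (G H : Set (MvPolynomial σ k)),
    Y ∪ Z = Set.univ ∧ Disjoint Y Z ∧ S = G ∪ H ∧ G.Nonempty ∧ H.Nonempty ∧
      (∀ f ∈ G, (f.vars : Set σ) ⊆ Y) ∧ (∀ f ∈ H, (f.vars : Set σ) ⊆ Z)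

/-- A set of forms is cohesive if the forms have no non-trivial common factor and the set cannot
be disconnected. -/
def Cohesive {σ k : Type*} [Field k] (S : Set (MvPolynomial σ k)) : Prop :=
  NoCommonFactor S ∧ ¬ CanBeDisconnected S

/-- The set of monomials `x ^ v` with exponent vector `v` in `E`. -/
noncomputable def monomialSet (k : Type*) [Field k] {n : ℕ} (E : Set (Fin n →₀ ℕ)) :
    Set (MvPolynomial (Fin n) k) :=
  (fun v => MvPolynomial.monomial v (1 : k)) '' E

/-- The monomial subring `k[F]` of `k[x₁, …, xₙ]`, with `F` the set of monomials `x ^ v`,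
`v ∈ E`. -/
noncomputable def monomialSubring (k : Type*) [Field k] {n : ℕ} (E : Set (Fin n →₀ ℕ)) :
    Subalgebra k (MvPolynomial (Fin n) k) :=
  Algebra.adjoin k (monomialSet k E)

/-- The exponent vectors of all monomials of degree `d` in `n` variables. -/
def degreeExponents (n d : ℕ) : Set (Fin n →₀ ℕ) :=
  {v | v.degree = d}

theorem monomialSubring_mono (k : Type*) [Field k] {n : ℕ} {E E' : Set (Fin n →₀ ℕ)}
    (h : E ⊆ E') : monomialSubring k E ≤ monomialSubring k E' :=
  Algebra.adjoin_mono (Set.image_mono h)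

/-- An extension `A ⊆ B` of subalgebras of a domain is birational if the induced map of fields of
fractions is an isomorphism. -/
def BirationalExtension {k R : Type*} [Field k] [CommRing R] [IsDomain R] [Algebra k R]
    {A B : Subalgebra k R} (h : A ≤ B) : Prop :=
  Function.Bijective
    (IsFractionRing.map (A := A) (B := B) (K := FractionRing A) (L := FractionRing B)
      (j := (Subalgebra.inclusion h : A →+* B)) (Subalgebra.inclusion_injective h))

/-- The log-matrix: the integer matrix whose columns are the exponent vectors in `E`. In degree
two, the column of `x_i x_j` is `e_i + e_j` (and `2 e_i` if `i = j`). -/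
def logMatrix {n : ℕ} (E : Finset (Fin n →₀ ℕ)) : Matrix (Fin n) E ℤ :=
  Matrix.of fun i v => (v.1 i : ℤ)

/-- The edges and loops of the graph with loops attached to a set of monomials of degree two:
the pairs `{i, j}`, possibly `i = j`, such that `x_i x_j` is one of the monomials. -/
def loopGraphEdges {n : ℕ} (E : Finset (Fin n →₀ ℕ)) : Set (Sym2 (Fin n)) :=
  {e | ∃ i j : Fin n, e = s(i, j) ∧ Finsupp.single i 1 + Finsupp.single j 1 ∈ E}

/-- The underlying simple graph, on all of the variables, obtained by omitting the loops. -/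
def underlyingGraph {n : ℕ} (E : Finset (Fin n →₀ ℕ)) : SimpleGraph (Fin n) :=
  SimpleGraph.fromEdgeSet (loopGraphEdges E)

/-! Birationality is a lattice question independent of `k`: it says that every `e_i + e_j` lies in
the lattice `L` spanned by the exponent vectors of `F` (`birationalExtension_monomialSubring_iff`).
If it holds, a linear form killing `L` kills every `2 e_i`, so the rank is full, and a disconnection
of `F` is excluded by parity of coordinate sums. If the rank is full, every variable occurs in `F`,
so a disconnected graph would disconnect `F`; and a 2-colouring without loops would give a `±1`
vector orthogonal to all columns. Finally, if the graph is connected, walks to a root `r` give `e_i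
± e_r ∈ L`; an obstruction to 2-colouring, or a loop, puts `2 e_r` in `L`, and then `L` contains
every `e_i + e_j`. -/

open MvPolynomial

/-! ### Birationality as clearing of denominators -/

section Birational

variable {k R : Type*} [Field k] [CommRing R] [IsDomain R] [Algebra k R]

theorem birationalExtension_iff {A B : Subalgebra k R} (h : A ≤ B) :
    BirationalExtension h ↔ ∀ b ∈ B, ∃ s ∈ A, s ≠ 0 ∧ s * b ∈ A := by
  have hmap (x : A) : IsFractionRing.map (A := A) (B := B) (K := FractionRing A)
      (L := FractionRing B) (j := (Subalgebra.inclusion h : A →+* B))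
      (Subalgebra.inclusion_injective h) (algebraMap A (FractionRing A) x) =
        algebraMap B (FractionRing B) (Subalgebra.inclusion h x) := by
    simp [IsFractionRing.map]
  constructor
  · intro hb b hbB
    obtain ⟨y, hy⟩ := hb.2 (algebraMap B (FractionRing B) ⟨b, hbB⟩)
    obtain ⟨a, s, hs, rfl⟩ := IsFractionRing.div_surjective (A := A) y
    have hs0 : s ≠ 0 := nonZeroDivisors.ne_zero hs
    refine ⟨s, s.2, by simpa using hs0, ?_⟩
    rw [map_div₀, hmap, hmap, div_eq_iff, ← map_mul] at hy
    · have := congrArg Subtype.val (IsFractionRing.injective B (FractionRing B) hy)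
      have h2 : (a : R) = b * s := by simpa using this
      rw [mul_comm, ← h2]
      exact a.2
    · rw [Ne, IsFractionRing.to_map_eq_zero_iff]
      intro h0
      exact hs0 (Subalgebra.inclusion_injective h (by simpa using h0))
  · intro H
    refine ⟨RingHom.injective _, ?_⟩
    have key (b : B) : ∃ y, IsFractionRing.map (A := A) (B := B) (K := FractionRing A)
        (L := FractionRing B) (j := (Subalgebra.inclusion h : A →+* B))
        (Subalgebra.inclusion_injective h) y = algebraMap B (FractionRing B) b := by
      obtain ⟨s, hs, hs0, hsb⟩ := H b b.2
      refine ⟨algebraMap A (FractionRing A) ⟨s * b, hsb⟩ /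
        algebraMap A (FractionRing A) ⟨s, hs⟩, ?_⟩
      rw [map_div₀, hmap, hmap, div_eq_iff, ← map_mul]
      · congr 1
        ext
        simp [mul_comm]
      · rw [Ne, IsFractionRing.to_map_eq_zero_iff]
        intro h0
        exact hs0 (by simpa using congrArg Subtype.val h0)
    intro z
    obtain ⟨a, s, hs, rfl⟩ := IsFractionRing.div_surjective (A := B) z
    obtain ⟨ya, hya⟩ := key a
    obtain ⟨ys, hys⟩ := key s
    exact ⟨ya / ys, by rw [map_div₀, hya, hys]⟩

/-- The elements of a domain that are fractions of elements of a subalgebra `A`. -/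
def Subalgebra.fractions (A : Subalgebra k R) : Subalgebra k R where
  carrier := {b | ∃ s ∈ A, s ≠ 0 ∧ s * b ∈ A}
  mul_mem' := by
    rintro a b ⟨s, hs, hs0, hsa⟩ ⟨t, ht, ht0, htb⟩
    refine ⟨s * t, A.mul_mem hs ht, mul_ne_zero hs0 ht0, ?_⟩
    rw [mul_mul_mul_comm]
    exact A.mul_mem hsa htb
  add_mem' := by
    rintro a b ⟨s, hs, hs0, hsa⟩ ⟨t, ht, ht0, htb⟩
    refine ⟨s * t, A.mul_mem hs ht, mul_ne_zero hs0 ht0, ?_⟩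
    rw [show s * t * (a + b) = t * (s * a) + s * (t * b) by ring]
    exact A.add_mem (A.mul_mem ht hsa) (A.mul_mem hs htb)
  algebraMap_mem' r := ⟨1, A.one_mem, one_ne_zero, by simp⟩

end Birational

/-! ### Semigroups and lattices of exponent vectors -/

section Lattice

variable {n : ℕ}

/-- An exponent vector as an integer vector. -/
def integerExponent (v : Fin n →₀ ℕ) : Fin n → ℤ := fun i => (v i : ℤ)

/-- The lattice generated by a set of exponent vectors. -/
def exponentLattice (E : Set (Fin n →₀ ℕ)) : AddSubgroup (Fin n → ℤ) :=
  AddSubgroup.closure (integerExponent '' E)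

theorem integerExponent_add (v w : Fin n →₀ ℕ) :
    integerExponent (v + w) = integerExponent v + integerExponent w := by
  ext i; simp [integerExponent]

theorem integerExponent_injective : Function.Injective (integerExponent (n := n)) := by
  intro v w h
  ext i
  simpa [integerExponent] using congrFun h i

theorem integerExponent_single (i : Fin n) :
    integerExponent (Finsupp.single i 1) = Pi.single i 1 := by
  ext j
  by_cases h : j = i
  · subst h; simp [integerExponent]
  · simp [integerExponent, h]

theorem integerExponent_pair (i j : Fin n) :
    integerExponent (Finsupp.single i 1 + Finsupp.single j 1) =
      Pi.single i 1 + Pi.single j 1 := by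
  rw [integerExponent_add, integerExponent_single, integerExponent_single]

theorem integerExponent_mem_exponentLattice {E : Set (Fin n →₀ ℕ)} {v : Fin n →₀ ℕ}
    (hv : v ∈ AddSubmonoid.closure E) : integerExponent v ∈ exponentLattice E := by
  induction hv using AddSubmonoid.closure_induction with
  | mem v hv => exact AddSubgroup.subset_closure ⟨v, hv, rfl⟩
  | zero =>
    convert (exponentLattice E).zero_mem
    ext; simp [integerExponent]
  | add v w _ _ hv hw =>
    rw [integerExponent_add]
    exact add_mem hv hw

theorem exists_add_eq_of_mem_exponentLattice {E : Set (Fin n →₀ ℕ)} {z : Fin n → ℤ}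
    (hz : z ∈ exponentLattice E) : ∃ v ∈ AddSubmonoid.closure E, ∃ w ∈ AddSubmonoid.closure E,
      z + integerExponent w = integerExponent v := by
  induction hz using AddSubgroup.closure_induction with
  | mem z hz =>
    obtain ⟨v, hv, rfl⟩ := hz
    exact ⟨v, AddSubmonoid.subset_closure hv, 0, zero_mem _, by ext; simp [integerExponent]⟩
  | zero => exact ⟨0, zero_mem _, 0, zero_mem _, by simp⟩
  | add x y _ _ hx hy =>
    obtain ⟨v, hv, w, hw, h⟩ := hx
    obtain ⟨v', hv', w', hw', h'⟩ := hy
    refine ⟨v + v', add_mem hv hv', w + w', add_mem hw hw', ?_⟩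
    rw [integerExponent_add, integerExponent_add, ← h, ← h']
    abel
  | neg x _ hx =>
    obtain ⟨v, hv, w, hw, h⟩ := hx
    exact ⟨w, hw, v, hv, by rw [← h]; abel⟩

theorem exists_pair_of_degree_eq_two {v : Fin n →₀ ℕ} (hv : v.degree = 2) :
    ∃ i j, v = Finsupp.single i 1 + Finsupp.single j 1 := by
  have hc : (Finsupp.toMultiset v).card = 2 := by
    rw [Finsupp.card_toMultiset, ← hv]
    rfl
  obtain ⟨i, j, hij⟩ := Multiset.card_eq_two.1 hc
  refine ⟨i, j, ?_⟩
  rw [← Finsupp.toMultiset_toFinsupp v, hij, Multiset.insert_eq_cons, ← Multiset.singleton_add, map_add,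
    Multiset.toFinsupp_singleton, Multiset.toFinsupp_singleton]

theorem degree_pair (i j : Fin n) :
    (Finsupp.single i 1 + Finsupp.single j 1 : Fin n →₀ ℕ).degree = 2 := by
  simp [map_add]

end Lattice

/-! ### From monomial subrings to lattices -/

section MonomialSubring

variable {k : Type*} [Field k] {n : ℕ}

theorem monomial_mem_monomialSubring {E : Set (Fin n →₀ ℕ)} {v : Fin n →₀ ℕ}
    (hv : v ∈ AddSubmonoid.closure E) : monomial v (1 : k) ∈ monomialSubring k E := by
  induction hv using AddSubmonoid.closure_induction with
  | mem v hv => exact Algebra.subset_adjoin ⟨v, hv, rfl⟩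
  | zero => exact one_mem _
  | add v w _ _ hv hw =>
    rw [show monomial (v + w) (1 : k) = monomial v 1 * monomial w 1 by simp [monomial_mul]]
    exact mul_mem hv hw

theorem mem_closure_of_mem_support {E : Set (Fin n →₀ ℕ)} {f : MvPolynomial (Fin n) k}
    (hf : f ∈ monomialSubring k E) : ∀ v ∈ f.support, v ∈ AddSubmonoid.closure E := by
  classical
  induction hf using Algebra.adjoin_induction with
  | mem f hf =>
    obtain ⟨w, hw, rfl⟩ := hf
    intro v hv
    rw [Finset.mem_singleton.1 (support_monomial_subset hv)]
    exact AddSubmonoid.subset_closure hw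
  | algebraMap r =>
    intro v hv
    rw [algebraMap_eq, C_apply] at hv
    rw [Finset.mem_singleton.1 (support_monomial_subset hv)]
    exact zero_mem _
  | add f g _ _ hf hg =>
    intro v hv
    rcases Finset.mem_union.1 (support_add hv) with h | h
    exacts [hf v h, hg v h]
  | mul f g _ _ hf hg =>
    intro v hv
    obtain ⟨a, ha, b, hb, rfl⟩ := Finset.mem_add.1 (support_mul f g hv)
    exact add_mem (hf a ha) (hg b hb)

/-- If `s` and `s * x^v` both lie in `k[E]` with `s ≠ 0`, any `w` in the support of `s` makes `w`
and `w + v` semigroup elements, with difference `v`. Conversely, writing `v` as such a difference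
supplies a monomial denominator. -/
theorem birationalExtension_monomialSubring_iff {E E' : Set (Fin n →₀ ℕ)} (h : E ⊆ E') :
    BirationalExtension (monomialSubring_mono k h) ↔
      ∀ v ∈ E', integerExponent v ∈ exponentLattice E := by
  rw [birationalExtension_iff]
  constructor
  · intro H v hv
    obtain ⟨s, hs, hs0, hsv⟩ := H _ (monomial_mem_monomialSubring (AddSubmonoid.subset_closure hv))
    obtain ⟨w, hw⟩ := support_nonempty.2 hs0
    have hwv : w + v ∈ (s * monomial v (1 : k)).support := by
      rw [mem_support_iff, coeff_mul_monomial, mul_one]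
      exact mem_support_iff.1 hw
    have h1 := integerExponent_mem_exponentLattice (mem_closure_of_mem_support hs w hw)
    have h2 := integerExponent_mem_exponentLattice (mem_closure_of_mem_support hsv _ hwv)
    rw [integerExponent_add] at h2
    exact ((exponentLattice E).add_mem_cancel_left h1).1 h2
  · intro H
    suffices monomialSubring k E' ≤ (monomialSubring k E).fractions from fun b hb => this hb
    refine Algebra.adjoin_le ?_
    rintro _ ⟨v, hv, rfl⟩
    obtain ⟨a, ha, b, hb, hab⟩ := exists_add_eq_of_mem_exponentLattice (H v hv)
    refine ⟨monomial b 1, monomial_mem_monomialSubring hb, by simp, ?_⟩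
    rw [← integerExponent_add] at hab
    have := integerExponent_injective hab
    rw [monomial_mul, mul_one, add_comm, this]
    exact monomial_mem_monomialSubring ha

end MonomialSubring

/-! ### Rank, cohesiveness and the graph -/

section Graph

variable {n : ℕ} {E : Finset (Fin n →₀ ℕ)}

theorem logMatrix_rank_eq_iff :
    ((logMatrix E).map (Int.cast : ℤ → ℚ)).rank = n ↔
      ∀ c : Fin n → ℚ, (∀ v ∈ E, ∑ i, c i * (v i : ℚ) = 0) → c = 0 := by
  have h1 : ((logMatrix E).map (Int.cast : ℤ → ℚ)).rank = n ↔
      LinearIndependent ℚ ((logMatrix E).map (Int.cast : ℤ → ℚ)).row := by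
    rw [linearIndependent_iff_card_eq_finrank_span, Matrix.rank_eq_finrank_span_row,
      Fintype.card_fin, eq_comm, Set.finrank]
  rw [h1, Fintype.linearIndependent_iff]
  refine forall_congr' fun c => ?_
  have h2 : ∑ i, c i • ((logMatrix E).map (Int.cast : ℤ → ℚ)).row i = 0 ↔
      ∀ v ∈ E, ∑ i, c i * (v i : ℚ) = 0 := by
    rw [funext_iff, Subtype.forall]
    simp [Finset.sum_apply, logMatrix, Matrix.row]
  rw [h2, funext_iff]
  rfl

theorem sum_mul_pair (c : Fin n → ℚ) (i j : Fin n) :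
    ∑ l, c l * ((Finsupp.single i 1 + Finsupp.single j 1 : Fin n →₀ ℕ) l : ℚ) = c i + c j := by
  simp [Finsupp.single_apply, mul_add, Finset.sum_add_distrib]

theorem mk_mem_loopGraphEdges_iff {i j : Fin n} :
    s(i, j) ∈ loopGraphEdges E ↔ Finsupp.single i 1 + Finsupp.single j 1 ∈ E := by
  constructor
  · rintro ⟨a, b, hab, h⟩
    rcases Sym2.eq_iff.1 hab with ⟨rfl, rfl⟩ | ⟨rfl, rfl⟩
    · exact h
    · rwa [add_comm]
  · exact fun h => ⟨i, j, rfl, h⟩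

theorem underlyingGraph_adj_iff {i j : Fin n} :
    (underlyingGraph E).Adj i j ↔ Finsupp.single i 1 + Finsupp.single j 1 ∈ E ∧ i ≠ j := by
  rw [underlyingGraph, SimpleGraph.fromEdgeSet_adj, mk_mem_loopGraphEdges_iff]

theorem exists_loop_iff :
    (loopGraphEdges E \ (underlyingGraph E).edgeSet).Nonempty ↔
      ∃ i, Finsupp.single i 1 + Finsupp.single i 1 ∈ E := by
  constructor
  · rintro ⟨e, ⟨i, j, rfl, h⟩, he⟩
    rw [SimpleGraph.mem_edgeSet, underlyingGraph_adj_iff] at he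
    obtain rfl : i = j := by
      by_contra hij
      exact he ⟨h, hij⟩
    exact ⟨i, h⟩
  · rintro ⟨i, h⟩
    exact ⟨s(i, i), ⟨i, i, rfl, h⟩, by simp⟩

theorem not_canBeDisconnected {k : Type*} [Field k]
    (hdeg : (E : Set (Fin n →₀ ℕ)) ⊆ degreeExponents n 2)
    (hL : ∀ v ∈ degreeExponents n 2, integerExponent v ∈ exponentLattice (E : Set (Fin n →₀ ℕ))) :
    ¬ CanBeDisconnected (monomialSet k (E : Set (Fin n →₀ ℕ))) := by
  classical
  rintro ⟨Y, Z, G, H, -, hYZ, hGH, ⟨g, hg⟩, ⟨h, hh⟩, hGY, hHZ⟩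
  have vars_pair (i j : Fin n) :
      (monomial (Finsupp.single i 1 + Finsupp.single j 1) (1 : k)).vars = {i, j} := by
    rw [vars_monomial one_ne_zero]
    ext l
    simp only [Finsupp.mem_support_iff, Finsupp.add_apply, Finsupp.single_apply,
      Finset.mem_insert, Finset.mem_singleton]
    grind
  have hpair {f : MvPolynomial (Fin n) k} (hf : f ∈ G ∪ H) :
      ∃ i j, f = monomial (Finsupp.single i 1 + Finsupp.single j 1) (1 : k) := by
    rw [← hGH] at hf
    obtain ⟨v, hv, rfl⟩ := hf
    obtain ⟨i, j, rfl⟩ := exists_pair_of_degree_eq_two (hdeg hv)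
    exact ⟨i, j, rfl⟩
  obtain ⟨i, i', rfl⟩ := hpair (Or.inl hg)
  obtain ⟨j, j', rfl⟩ := hpair (Or.inr hh)
  have hi : i ∈ Y := hGY _ hg (by simp [vars_pair])
  have hj : j ∈ Z := hHZ _ hh (by simp [vars_pair])
  have hjY : j ∉ Y := fun hjY => Set.disjoint_left.1 hYZ hjY hj
  -- The sum of the coordinates in `Y` is 2 or 0 on each generator, hence even on the lattice, but
  -- it is 1 on `e_i + e_j`.
  let φ : (Fin n → ℤ) →+ ℤ :=
    { toFun := fun z => ∑ l, if l ∈ Y then z l else 0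
      map_zero' := by simp
      map_add' := fun x y => by
        rw [← Finset.sum_add_distrib]
        refine Finset.sum_congr rfl fun l _ => ?_
        split_ifs <;> simp }
  have hφ (a b : Fin n) : φ (Pi.single a 1 + Pi.single b 1) =
      (if a ∈ Y then 1 else 0) + if b ∈ Y then 1 else 0 := by
    have hs (a : Fin n) : φ (Pi.single a 1) = if a ∈ Y then 1 else 0 := by
      change (∑ l, if l ∈ Y then (Pi.single a 1 : Fin n → ℤ) l else 0) = _
      rw [Finset.sum_eq_single a]
      · simp
      · intro b _ hb
        simp [hb]
      · simp
    rw [map_add, hs, hs]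
  have heven : exponentLattice (E : Set (Fin n →₀ ℕ)) ≤ (AddSubgroup.zmultiples (2 : ℤ)).comap φ := by
    refine (AddSubgroup.closure_le _).2 ?_
    rintro _ ⟨v, hv, rfl⟩
    obtain ⟨a, b, rfl⟩ := exists_pair_of_degree_eq_two (hdeg hv)
    have hmem : monomial (Finsupp.single a 1 + Finsupp.single b 1) (1 : k) ∈ G ∪ H := by
      rw [← hGH]
      exact ⟨_, hv, rfl⟩
    rw [SetLike.mem_coe, AddSubgroup.mem_comap, integerExponent_pair, hφ, Int.mem_zmultiples_iff]
    rcases hmem with hm | hm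
    · have := hGY _ hm
      rw [vars_pair] at this
      rw [if_pos (this (by simp)), if_pos (this (by simp))]
      norm_num
    · have := hHZ _ hm
      rw [vars_pair] at this
      rw [if_neg (Set.disjoint_right.1 hYZ (this (by simp))),
        if_neg (Set.disjoint_right.1 hYZ (this (by simp)))]
      norm_num
  have := heven (hL _ (degree_pair i j))
  rw [AddSubgroup.mem_comap, integerExponent_pair, hφ, Int.mem_zmultiples_iff, if_pos hi,
    if_neg hjY] at this
  norm_num at this

theorem logMatrix_rank_eq
    (hL : ∀ v ∈ degreeExponents n 2, integerExponent v ∈ exponentLattice (E : Set (Fin n →₀ ℕ))) :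
    ((logMatrix E).map (Int.cast : ℤ → ℚ)).rank = n := by
  rw [logMatrix_rank_eq_iff]
  intro c hc
  let φ : (Fin n → ℤ) →+ ℚ :=
    { toFun := fun z => ∑ l, c l * (z l : ℚ)
      map_zero' := by simp
      map_add' := fun x y => by simp [mul_add, Finset.sum_add_distrib] }
  have hker : exponentLattice (E : Set (Fin n →₀ ℕ)) ≤ φ.ker := by
    refine (AddSubgroup.closure_le _).2 ?_
    rintro _ ⟨v, hv, rfl⟩
    simpa [φ, integerExponent] using hc v hv
  ext i
  have h1 : ∑ l, c l * ((integerExponent (Finsupp.single i 1 + Finsupp.single i 1) l : ℤ) : ℚ) = 0 :=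
    hker (hL _ (degree_pair i i))
  have h2 := sum_mul_pair c i i
  simp only [integerExponent, Int.cast_natCast] at h1
  rw [h1] at h2
  simp only [Pi.zero_apply]
  linarith

theorem underlyingGraph_connected {k : Type*} [Field k] [Nonempty (Fin n)]
    (hdeg : (E : Set (Fin n →₀ ℕ)) ⊆ degreeExponents n 2)
    (hE : ¬ CanBeDisconnected (monomialSet k (E : Set (Fin n →₀ ℕ))))
    (hrank : ((logMatrix E).map (Int.cast : ℤ → ℚ)).rank = n) :
    (underlyingGraph E).Connected := by
  classical
  rw [logMatrix_rank_eq_iff] at hrank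
  -- Every variable occurs in `F`; otherwise its coordinate form would kill all columns. This makes
  -- both sides of the disconnection below non-empty.
  have happ (i : Fin n) : ∃ j, Finsupp.single i 1 + Finsupp.single j 1 ∈ E := by
    by_contra! hi
    have := congrFun (hrank (Pi.single i 1) fun v hv => ?_) i
    · simp at this
    · obtain ⟨a, b, rfl⟩ := exists_pair_of_degree_eq_two (hdeg hv)
      have ha : a ≠ i := by
        rintro rfl
        exact hi b hv
      have hb : b ≠ i := by
        rintro rfl
        rw [add_comm] at hv
        exact hi a hv
      rw [sum_mul_pair]
      simp [ha, hb]
  have hreach {a b : Fin n} (h : Finsupp.single a 1 + Finsupp.single b 1 ∈ E) :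
      (underlyingGraph E).Reachable a b := by
    by_cases hab : a = b
    · rw [hab]
    · exact (underlyingGraph_adj_iff.2 ⟨h, hab⟩).reachable
  have hvars (a b : Fin n) :
      ((monomial (Finsupp.single a 1 + Finsupp.single b 1) (1 : k)).vars : Set (Fin n)) ⊆
        {a, b} := by
    rw [vars_monomial one_ne_zero]
    intro l
    simp only [Finset.mem_coe, Finsupp.mem_support_iff, Finsupp.add_apply, Finsupp.single_apply,
      Set.mem_insert_iff, Set.mem_singleton_iff]
    grind
  refine ⟨fun r t => ?_⟩
  by_contra hrt
  let Y : Set (Fin n) := {l | (underlyingGraph E).Reachable r l}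
  let P (S : Set (Fin n)) : Set (MvPolynomial (Fin n) k) :=
    {f | f ∈ monomialSet k (E : Set (Fin n →₀ ℕ)) ∧ (f.vars : Set (Fin n)) ⊆ S}
  refine hE ⟨Y, Yᶜ, P Y, P Yᶜ, Set.union_compl_self Y, disjoint_compl_right, ?_, ?_, ?_,
    fun f hf => hf.2, fun f hf => hf.2⟩
  · refine Set.Subset.antisymm (fun f hf => ?_) (Set.union_subset (fun f hf => hf.1) fun f hf => hf.1)
    obtain ⟨v, hv, rfl⟩ := id hf
    obtain ⟨a, b, rfl⟩ := exists_pair_of_degree_eq_two (hdeg hv)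
    by_cases ha : a ∈ Y
    · refine Or.inl ⟨hf, (hvars a b).trans ?_⟩
      rintro l (rfl | rfl)
      exacts [ha, SimpleGraph.Reachable.trans ha (hreach hv)]
    · refine Or.inr ⟨hf, (hvars a b).trans ?_⟩
      rintro l (rfl | rfl)
      exacts [ha, fun hb => ha (SimpleGraph.Reachable.trans hb (hreach hv).symm)]
  · obtain ⟨j, hj⟩ := happ r
    refine ⟨_, ⟨_, hj, rfl⟩, (hvars r j).trans ?_⟩
    rintro l (rfl | rfl)
    exacts [SimpleGraph.Reachable.refl _, hreach hj]
  · obtain ⟨j, hj⟩ := happ t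
    refine ⟨_, ⟨_, hj, rfl⟩, (hvars t j).trans ?_⟩
    rintro l (rfl | rfl)
    exacts [hrt, fun h => hrt (SimpleGraph.Reachable.trans h (hreach hj).symm)]

theorem exists_loop_of_isBipartite [Nonempty (Fin n)]
    (hdeg : (E : Set (Fin n →₀ ℕ)) ⊆ degreeExponents n 2)
    (hrank : ((logMatrix E).map (Int.cast : ℤ → ℚ)).rank = n)
    (hbip : (underlyingGraph E).IsBipartite) :
    ∃ i, Finsupp.single i 1 + Finsupp.single i 1 ∈ E := by
  by_contra! hloop
  rw [logMatrix_rank_eq_iff] at hrank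
  obtain ⟨C⟩ := hbip
  let c : Fin n → ℚ := fun i => if C i = 0 then 1 else -1
  have hc := hrank c fun v hv => by
    obtain ⟨a, b, rfl⟩ := exists_pair_of_degree_eq_two (hdeg hv)
    have hab : a ≠ b := by
      rintro rfl
      exact hloop a hv
    have hC := C.valid (underlyingGraph_adj_iff.2 ⟨hv, hab⟩)
    rw [sum_mul_pair]
    simp only [c]
    split_ifs with h1 h2 h2
    · exact absurd (h1.trans h2.symm) hC
    · norm_num
    · norm_num
    · omega
  obtain ⟨i⟩ := ‹Nonempty (Fin n)›
  have := congrFun hc i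
  simp only [c, Pi.zero_apply] at this
  split_ifs at this <;> norm_num at this

theorem mem_exponentLattice_of_connected (hconn : (underlyingGraph E).Connected)
    (h : ¬ (underlyingGraph E).IsBipartite ∨ ∃ i, Finsupp.single i 1 + Finsupp.single i 1 ∈ E) :
    ∀ v ∈ degreeExponents n 2, integerExponent v ∈ exponentLattice (E : Set (Fin n →₀ ℕ)) := by
  classical
  set L := exponentLattice (E : Set (Fin n →₀ ℕ))
  have hmem {i j : Fin n} (hij : Finsupp.single i 1 + Finsupp.single j 1 ∈ E) :
      (Pi.single i 1 + Pi.single j 1 : Fin n → ℤ) ∈ L := by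
    rw [← integerExponent_pair]
    exact AddSubgroup.subset_closure ⟨_, hij, rfl⟩
  obtain ⟨r⟩ := hconn.nonempty
  let e (i : Fin n) : Fin n → ℤ := Pi.single i 1
  have hadj {i j : Fin n} (hij : (underlyingGraph E).Adj i j) : e i + e j ∈ L :=
    hmem (underlyingGraph_adj_iff.1 hij).1
  -- Each edge of the walk flips the sign: `(e_a + e_b) - (e_b ± e_r) = e_a ∓ e_r`.
  have hpm (i : Fin n) : e i + e r ∈ L ∨ e i - e r ∈ L := by
    obtain ⟨p⟩ := hconn.preconnected i r
    induction p with
    | nil => simp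
    | cons hab _ ih =>
      rcases ih with ih | ih
      · right
        convert sub_mem (hadj hab) ih using 1
        abel
      · left
        convert sub_mem (hadj hab) ih using 1
        abel
  have hr : e r + e r ∈ L := by
    rcases h with hbip | ⟨i, hi⟩
    · by_contra hr
      -- If `2 e_r` is not in `L`, the sign in `e_i ± e_r ∈ L` is a proper 2-colouring: an edge with
      -- ends of equal sign would yield `2 e_r`.
      refine hbip ⟨SimpleGraph.Coloring.mk (fun i => if e i + e r ∈ L then 0 else 1) ?_⟩
      intro a b hab
      have h1 := hadj hab
      split_ifs with ha hb hb
      · refine fun _ => hr ?_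
        convert sub_mem (add_mem ha hb) h1 using 1
        abel
      · simp
      · simp
      · refine fun _ => hr ?_
        convert sub_mem h1 (add_mem ((hpm a).resolve_left ha) ((hpm b).resolve_left hb)) using 1
        abel
    · have hi' : e i + e i ∈ L := hmem hi
      rcases hpm i with h1 | h1
      · convert sub_mem (add_mem h1 h1) hi' using 1
        abel
      · convert sub_mem hi' (add_mem h1 h1) using 1
        abel
  intro v hv
  obtain ⟨i, j, rfl⟩ := exists_pair_of_degree_eq_two hv
  rw [integerExponent_pair]
  change e i + e j ∈ L
  have hp (i : Fin n) : e i + e r ∈ L := by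
    rcases hpm i with h1 | h1
    · exact h1
    · convert add_mem h1 hr using 1
      abel
  convert sub_mem (add_mem (hp i) (hp j)) hr using 1
  abel

end Graph

theorem theorem4 (k : Type*) [Field k] (n : ℕ) (E : Finset (Fin n →₀ ℕ))
    (hdeg : (E : Set (Fin n →₀ ℕ)) ⊆ degreeExponents n 2)
    (hgcd : NoCommonFactor (monomialSet k (E : Set (Fin n →₀ ℕ)))) :
    List.TFAE
      [ Cohesive (monomialSet k (E : Set (Fin n →₀ ℕ))) ∧
          ((logMatrix E).map (Int.cast : ℤ → ℚ)).rank = n,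
        BirationalExtension (monomialSubring_mono k hdeg),
        (underlyingGraph E).Connected ∧
          (¬ (underlyingGraph E).IsBipartite ∨
            ((underlyingGraph E).IsBipartite ∧
              (loopGraphEdges E \ (underlyingGraph E).edgeSet).Nonempty)) ] := by
  -- Without variables `F` would be empty, and then `0` would be a non-unit common factor.
  have hne : Nonempty (Fin n) := by
    by_contra hn
    rw [not_nonempty_iff] at hn
    refine not_isUnit_zero (hgcd 0 ?_)
    rintro _ ⟨v, hv, rfl⟩
    obtain ⟨i, -⟩ := exists_pair_of_degree_eq_two (hdeg hv)
    exact isEmptyElim i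
  tfae_have 2 → 1 := fun h => by
    rw [birationalExtension_monomialSubring_iff hdeg] at h
    exact ⟨⟨hgcd, not_canBeDisconnected hdeg h⟩, logMatrix_rank_eq h⟩
  tfae_have 1 → 3 := fun ⟨hE, hrank⟩ => by
    refine ⟨underlyingGraph_connected hdeg hE.2 hrank, ?_⟩
    by_cases hbip : (underlyingGraph E).IsBipartite
    · exact Or.inr ⟨hbip, exists_loop_iff.2 (exists_loop_of_isBipartite hdeg hrank hbip)⟩
    · exact Or.inl hbip
  tfae_have 3 → 2 := fun ⟨hconn, h⟩ => by
    rw [birationalExtension_monomialSubring_iff hdeg]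
    exact mem_exponentLattice_of_connected hconn (h.imp_right fun h => exists_loop_iff.1 h.2)
  tfae_finish
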